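/- Let $\mathbb D$ be the open unit disc, let $\alpha,\beta>0$ be real numbers and let $n\ge 1$ be an integer. Let $\mathcal M^{(\alpha,\beta)}=\mathcal M^{(\alpha)}\otimes\mathcal M^{(\beta)}$ be the Hilbert space of functions on $\mathbb D^2$ with the reproducing kernel $$B^{(\alpha,\beta)}(z,w)=(1-z_1\bar w_1)^{-\alpha}(1-z_2\bar w_2)^{-\beta},\qquad z=(z_1,z_2),\ w=(w_1,w_2)\in\mathbb D^2 ,$$ and let $\mathcal J^{(n+1)}$ be the Hilbert space of $\mathbb C^{n+1}$-valued functions on $\mathbb D$ with the reproducing kernel $$K(z,w)=\Big(\partial_{z_2}^{\,i}\,\bar\partial_{w_2}^{\,j}B^{(\alpha,\beta)}\big((z_1,z_2),(w_1,w_2)\big)\Big|_{z_1=z_2=z,\ w_1=w_2=w}\Big)_{i,j=0}^{n},\qquad z,w\in\mathbb D .$$ (Both kernels are non-negative definite.) Then multiplication by the coordinate function, $(Mf)(z)=zf(z)$, is a bounded operator $M=M^{(\alpha,\beta)}$ on $\mathcal J^{(n+1)}$, and $M$ is irreducible: $\mathcal J^{(n+1)}\neq 0$ and the only closed subspaces of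 $\mathcal J^{(n+1)}$ invariant under both $M$ and $M^*$ are $0$ and $\mathcal J^{(n+1)}$. Moreover $\mathcal J^{(n+1)}$ is the quotient of $\mathcal M^{(\alpha,\beta)}$ by the functions vanishing to order $n+1$ on the diagonal, and $M$ is the corresponding compression. That is, multiplication by $z_1$ is a bounded operator on $\mathcal M^{(\alpha,\beta)}$, and if $\mathcal Q\subseteq\mathcal M^{(\alpha,\beta)}$ is the orthogonal complement of the set of all $f$ with $(\partial_{z_2}^{\,i}f)(z,z)=0$ for all $z\in\mathbb D$ and $0\le i\le n$, then $$h\longmapsto\Big(z\mapsto\big((\partial_{z_2}^{\,i}h)(z,z)\big)_{i=0}^{n}\Big)$$ is a unitary operator from $\mathcal Q$ onto $\mathcal J^{(n+1)}$ that intertwines the compression to $\mathcal Q$ of multiplication by $z_1$ with $M$. -/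

import Mathlib

open scoped ComplexConjugate

noncomputable section

namespace JetConstruction

/-- The open unit disc of the complex plane. -/
abbrev Disc : Type := Complex.UnitDisc

/-- The kernel `B(z, w) = (1 - z₁ w̄₁)^(-α) (1 - z₂ w̄₂)^(-β)`, written as a function of points
of `ℂ × ℂ`; on the bidisc both bases have positive real part, and the powers are principal. -/
def bidiscFun (α β : ℝ) (z w : ℂ × ℂ) : ℂ :=
  (1 - z.1 * conj w.1) ^ (-(α : ℂ)) * (1 - z.2 * conj w.2) ^ (-(β : ℂ))

/-- The kernel `B` on the bidisc, as an operator-valued kernel on the one-dimensional space `ℂ`.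
The reproducing kernel Hilbert space with this kernel is the tensor product of the spaces on the
disc with the kernels `(1 - z w̄)^(-α)` and `(1 - z w̄)^(-β)`. -/
def bidiscKernel (α β : ℝ) : Matrix (Disc × Disc) (Disc × Disc) (ℂ →L[ℂ] ℂ) :=
  Matrix.of fun z w =>
    bidiscFun α β ((z.1 : ℂ), (z.2 : ℂ)) ((w.1 : ℂ), (w.2 : ℂ)) • ContinuousLinearMap.id ℂ ℂ

/-- The `(i, j)` entry of the jet kernel restricted to the diagonal: `∂^i` in `z₂` and `∂̄^j` in
`w₂` of `B((z₁, z₂), (w₁, w₂))`, evaluated at `z₁ = z₂ = z`, `w₁ = w₂ = w`.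
As `B` is antiholomorphic in `w₂`, its `∂̄^j` derivative in `w₂` is the `j`-th complex derivative
of `η ↦ B(·, (w₁, η̄))` at `η = w̄₂`. -/
def jetEntry (α β : ℝ) (i j : ℕ) (z w : ℂ) : ℂ :=
  iteratedDeriv i
    (fun ζ : ℂ => iteratedDeriv j (fun η : ℂ => bidiscFun α β (z, ζ) (w, conj η)) (conj w)) z

/-- The space `ℂ^(n+1)` with its Euclidean norm. -/
abbrev Jets (n : ℕ) : Type := EuclideanSpace ℂ (Fin (n + 1))

/-- The jet kernel on the disc: the `(n+1) × (n+1)` matrix `(∂₂^i ∂̄₂^j B)` for `0 ≤ i, j ≤ n`,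
restricted to the diagonal of the bidisc and seen as an operator on `ℂ^(n+1)`. -/
def jetKernel (α β : ℝ) (n : ℕ) : Matrix Disc Disc (Jets n →L[ℂ] Jets n) :=
  Matrix.of fun z w =>
    Matrix.toEuclideanCLM (n := Fin (n + 1)) (𝕜 := ℂ)
      (Matrix.of fun i j : Fin (n + 1) => jetEntry α β (i : ℕ) (j : ℕ) (z : ℂ) (w : ℂ))

/-- The derivative `∂₂^i f` of a function on the bidisc, at the diagonal point `(z, z)`. -/
def diagDeriv (i : ℕ) (f : Disc × Disc → ℂ) (z : Disc) : ℂ :=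
  iteratedDeriv i
    (Function.extend (fun ζ : Disc => (ζ : ℂ)) (fun ζ : Disc => f (z, ζ)) 0) (z : ℂ)

/-- The `n`-jet of `f` in the direction of the second variable, restricted to the diagonal:
`(f, ∂₂ f, …, ∂₂^n f)` at `(z, z)`. -/
def jet (n : ℕ) (f : Disc × Disc → ℂ) (z : Disc) : Jets n :=
  WithLp.toLp 2 fun i : Fin (n + 1) => diagDeriv (i : ℕ) f z

/-- `f` vanishes to order `n + 1` on the diagonal: `f` and its first `n` derivatives with respect
to the second variable vanish there. -/
def VanishesOnDiagonal (n : ℕ) (f : Disc × Disc → ℂ) : Prop :=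
  ∀ i ≤ n, ∀ z : Disc, diagDeriv i f z = 0

section Operators

variable {H : Type*} [NormedAddCommGroup H] [InnerProductSpace ℂ H] [CompleteSpace H]

/-- The quotient module: the orthogonal complement, in a Hilbert space `H` of functions on the
bidisc, of the functions vanishing to order `n + 1` on the diagonal. -/
def quotientModule (H : Type*) [NormedAddCommGroup H] [InnerProductSpace ℂ H]
    [RKHS ℂ H (Disc × Disc) ℂ] (n : ℕ) : Submodule ℂ H :=
  (Submodule.span ℂ {f : H | VanishesOnDiagonal n (f : Disc × Disc → ℂ)})ᗮ

instance (n : ℕ) [RKHS ℂ H (Disc × Disc) ℂ] : CompleteSpace (quotientModule H n) :=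
  inferInstanceAs (CompleteSpace
    ↥(Submodule.span ℂ {f : H | VanishesOnDiagonal n (f : Disc × Disc → ℂ)})ᗮ)

/-- The compression `P T|_Q` of a bounded operator `T` to a closed subspace `Q`. -/
def compression (T : H →L[ℂ] H) (Q : Submodule ℂ H) [Q.HasOrthogonalProjection] : Q →L[ℂ] Q :=
  Q.orthogonalProjectionOnto ∘L T ∘L Q.subtypeL

/-- A bounded operator `T` on a nonzero Hilbert space is irreducible when its only reducing
subspaces (closed subspaces invariant under `T` and `T*`) are `0` and the whole space. -/
def IsIrreducibleOperator (T : H →L[ℂ] H) : Prop :=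
  Nontrivial H ∧
    ∀ S : Submodule ℂ H, IsClosed (S : Set H) → (∀ x ∈ S, T x ∈ S) →
      (∀ x ∈ S, ContinuousLinearMap.adjoint T x ∈ S) → S = ⊥ ∨ S = ⊤

end Operators

end JetConstruction

end

/-!
# The jet construction for the kernels `(1 - z₁ w̄₁)^(-α) (1 - z₂ w̄₂)^(-β)`

Both kernels are realised on the one Hilbert space `ℓ²(ℕ × ℕ)`. By the binomial series, whose
coefficients `negBinom` are positive, the derivatives of the normalised monomials `z₁^k z₂^l` at a
point form a vector `feature` of this space, and the pairings of these vectors are the entries of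
the kernels. A kernel with a feature map is positive semidefinite, and its Hilbert space is a
coisometric image of the feature space (`IsFeatureMap.exists_coisometry`). Termwise differentiation
(`diagDeriv_eq_inner_feature`) shows that the coisometry onto `J` factors through the one onto `H`
as `f ↦ jet n f`. So the jet map `H → J` is a coisometry whose kernel consists of the functions
vanishing to order `n + 1` on the diagonal, and it is unitary on the orthogonal complement. The
multiplication operators are adjoints of a bounded weighted backward shift in the first index, of
which the feature vectors are eigenvectors (`exists_backward_shift`).

Irreducibility is proved by linear algebra on the jets `u_{k,l}` of the monomials `z₁^k z₂^l`, which
are total in `J` and satisfy `M u_{k,l} = u_{k+1,l}`. The entries of `u_{k,l}` are, up to powers of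
`z`, polynomials of degree at most `n` in `l`, so that Lagrange interpolation at the nodes
`0, …, n` expresses every `u_{k,l}` through the `u_{k',i}` with `k' + i = k + l` and `i ≤ n`.
Consequently `ker M†` is spanned by `u_{0,0}, …, u_{0,n}`, and a projection `P` that commutes with
`M` and `M†` acts by `P u_{k,l} = ∑ j, Y j l • u_{k,j}` for `l ≤ n`, with a matrix `Y` that does not
depend on `k`. The dual vectors `dualVector` are biorthogonal to the `u_{k,l}`, and self-adjointness
of `P` on them gives equations between the entries of `Y`. Their coefficients in degree `n + 1` are
nonzero (`IsJetSystem.dualGram_succ_ne_zero`), because the binomial coefficients are positive and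
the Lagrange polynomials do not vanish at `n + 1`. The equations force `Y` to be a scalar matrix
(`IsJetSystem.exists_eq_smul`).
-/

namespace JetConstruction

/-! ### The binomial series -/

/-- The Taylor coefficients `γ (γ + 1) ⋯ (γ + k - 1) / k!` of `(1 - x) ^ (-γ)`. -/
noncomputable def negBinom (γ : ℝ) (k : ℕ) : ℝ :=
  (ascPochhammer ℝ k).eval γ / (k.factorial : ℝ)

lemma negBinom_pos {γ : ℝ} (hγ : 0 < γ) (k : ℕ) : 0 < negBinom γ k :=
  div_pos (ascPochhammer_pos k γ hγ) (by positivity)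

lemma negBinom_succ (γ : ℝ) (k : ℕ) :
    negBinom γ (k + 1) * (k + 1) = negBinom γ k * (γ + k) := by
  have : ((k.factorial : ℕ) : ℝ) ≠ 0 := by positivity
  have h' : (k : ℝ) + 1 ≠ 0 := by positivity
  rw [negBinom, negBinom, ascPochhammer_succ_eval, Nat.factorial_succ]
  push_cast
  field_simp

lemma hasSum_negBinom (γ : ℝ) {z : ℂ} (hz : ‖z‖ < 1) :
    HasSum (fun k => (negBinom γ k : ℂ) * z ^ k) ((1 - z) ^ (-(γ : ℂ))) := by
  have h := (Complex.one_add_cpow_hasFPowerSeriesOnBall_zero (a := -(γ : ℂ))).hasSum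
    (y := -z) (by simpa [← ofReal_norm, ENNReal.ofReal_lt_one] using hz)
  rw [zero_add, ← sub_eq_add_neg] at h
  convert! h using 2 with k
  have key : (k.factorial : ℂ) * Ring.multichoose (γ : ℂ) k = (ascPochhammer ℂ k).eval (γ : ℂ) := by
    rw [← nsmul_eq_mul, Ring.factorial_nsmul_multichoose_eq_ascPochhammer,
      Polynomial.ascPochhammer_smeval_cast, Polynomial.ascPochhammer_smeval_eq_eval]
  have key2 : (((ascPochhammer ℝ k).eval γ : ℝ) : ℂ) = (ascPochhammer ℂ k).eval (γ : ℂ) := by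
    rw [← ascPochhammer_map Complex.ofRealHom k]
    exact (Polynomial.eval_map_apply Complex.ofRealHom γ).symm
  have hk : (k.factorial : ℂ) ≠ 0 := by exact_mod_cast k.factorial_ne_zero
  rw [negBinom, binomialSeries_apply, Ring.choose_neg']
  push_cast
  rw [key2, ← key]
  simp [List.ofFn_const, neg_pow z k, Units.smul_def]
  field_simp
  ring_nf
  simp

lemma summable_negBinom {γ : ℝ} (hγ : 0 < γ) {r : ℝ} (h0 : 0 ≤ r) (h1 : r < 1) :
    Summable fun k => negBinom γ k * r ^ k := by
  have := (hasSum_negBinom γ (z := (r : ℂ)) (by simpa [abs_of_nonneg h0] using h1)).summable.norm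
  refine this.congr fun k => ?_
  simp [abs_of_nonneg h0, abs_of_pos (negBinom_pos hγ k)]

/-! ### Termwise differentiation of generalised power series -/

lemma descFactorial_mul_pow_le {r δ : ℝ} (hr : 0 ≤ r) (hδ : 0 < δ) (j l : ℕ) :
    (l.descFactorial j : ℝ) * r ^ (l - j) ≤ j.factorial * (δ ^ j)⁻¹ * (r + δ) ^ l := by
  rcases lt_or_ge l j with h | h
  · rw [Nat.descFactorial_eq_zero_iff_lt.2 h]
    simp only [Nat.cast_zero, zero_mul]
    positivity
  have h1 : r ^ (l - j) * δ ^ j * (l.choose j : ℝ) ≤ (r + δ) ^ l := by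
    rw [add_pow]
    have := Finset.single_le_sum (f := fun m => r ^ m * δ ^ (l - m) * (l.choose m : ℝ))
      (s := Finset.range (l + 1)) (fun m _ => by positivity)
      (Finset.mem_range.2 (show l - j < l + 1 by omega))
    simp only [Nat.sub_sub_self h, Nat.choose_symm h] at this
    exact this
  have h2 : (l.descFactorial j : ℝ) = j.factorial * l.choose j := by
    exact_mod_cast Nat.descFactorial_eq_factorial_mul_choose l j
  calc (l.descFactorial j : ℝ) * r ^ (l - j)
      = j.factorial * (δ ^ j)⁻¹ * (r ^ (l - j) * δ ^ j * (l.choose j : ℝ)) := by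
        rw [h2]; field_simp
    _ ≤ _ := by gcongr

section Termwise

variable {ι : Type*}

lemma summable_mul_descFactorial {c : ι → ℝ} (hc : ∀ i, 0 ≤ c i) {e : ι → ℕ}
    (h : ∀ r : ℝ, 0 ≤ r → r < 1 → Summable fun i => c i * r ^ e i) (j : ℕ)
    {r : ℝ} (h0 : 0 ≤ r) (h1 : r < 1) :
    Summable fun i => c i * (((e i).descFactorial j : ℝ) * r ^ (e i - j)) := by
  have hδ : 0 < (1 - r) / 2 := by linarith
  refine Summable.of_nonneg_of_le (fun i => mul_nonneg (hc i) (by positivity)) (fun i =>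
    mul_le_mul_of_nonneg_left (descFactorial_mul_pow_le h0 hδ j (e i)) (hc i)) ?_
  refine ((h (r + (1 - r) / 2) (by linarith) (by linarith)).mul_left
    (j.factorial * (((1 - r) / 2) ^ j)⁻¹)).congr fun i => ?_
  ring

/-- A series `∑ c_i ζ ^ (e i)` that converges absolutely on the unit disc may be differentiated
term by term. -/
lemma hasSum_iteratedDeriv {c : ι → ℂ} {e : ι → ℕ}
    (h : ∀ r : ℝ, 0 ≤ r → r < 1 → Summable fun i => ‖c i‖ * r ^ e i) (j : ℕ)
    {z : ℂ} (hz : ‖z‖ < 1) :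
    HasSum (fun i => c i * (((e i).descFactorial j : ℂ) * z ^ (e i - j)))
      (iteratedDeriv j (fun ζ => ∑' i, c i * ζ ^ e i) z) := by
  have hs (j : ℕ) {r : ℝ} (h0 : 0 ≤ r) (h1 : r < 1) :=
    summable_mul_descFactorial (fun i => norm_nonneg (c i)) h j h0 h1
  have hsum (j : ℕ) {z : ℂ} (hz : ‖z‖ < 1) :
      Summable fun i => c i * (((e i).descFactorial j : ℂ) * z ^ (e i - j)) := by
    refine Summable.of_norm ((hs j (norm_nonneg z) hz).congr fun i => ?_)
    simp
  induction j generalizing z with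
  | zero => simpa using (hsum 0 hz).hasSum
  | succ j ih =>
    obtain ⟨r, hzr, hr1⟩ := exists_between hz
    have h0 : 0 ≤ r := (norm_nonneg z).trans hzr.le
    have key := Complex.hasSum_deriv_of_summable_norm (U := Metric.ball (0 : ℂ) r) (z := z)
      (F := fun i ζ => c i * (((e i).descFactorial j : ℂ) * ζ ^ (e i - j)))
      (hs j h0 hr1) (fun i => by fun_prop) Metric.isOpen_ball (fun i w hw => by
        have : ‖w‖ ≤ r := (mem_ball_zero_iff.1 hw).le
        simp only [norm_mul, norm_pow, Complex.norm_natCast]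
        gcongr) (mem_ball_zero_iff.2 hzr)
    rw [iteratedDeriv_succ]
    convert! key using 1
    · ext i
      have hd : deriv (fun w : ℂ => w ^ (e i - j)) z = ((e i - j : ℕ) : ℂ) * z ^ (e i - j - 1) := by
        simp
      rw [deriv_const_mul _ (by fun_prop), deriv_const_mul _ (by fun_prop), hd,
        Nat.descFactorial_succ, Nat.sub_sub]
      push_cast
      ring
    · refine Filter.EventuallyEq.deriv_eq ?_
      filter_upwards [Metric.isOpen_ball.mem_nhds (mem_ball_zero_iff.2 hz)] with w hw
      exact (ih (mem_ball_zero_iff.1 hw)).tsum_eq.symm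

end Termwise

/-- Coefficients of a power series that vanishes identically on the disc are zero. -/
lemma eq_zero_of_hasSum_zero {c : ℕ → ℂ}
    (h : ∀ z : ℂ, ‖z‖ < 1 → HasSum (fun k => c k * z ^ k) 0) : c = 0 := by
  have hp : HasFPowerSeriesOnBall (fun _ : ℂ => (0 : ℂ)) (FormalMultilinearSeries.ofScalars ℂ c)
      0 (ENNReal.ofReal 2⁻¹) := by
    refine ⟨?_, by simp, ?_⟩
    · refine FormalMultilinearSeries.le_radius_of_tendsto (l := 0) _ ?_
      have := (h (2⁻¹ : ℝ) (by norm_num)).summable.norm.tendsto_atTop_zero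
      simpa using this
    · intro y hy
      have hy' : ‖y‖ < 1 := by
        rw [Metric.eball_ofReal, mem_ball_zero_iff] at hy
        norm_num at hy ⊢
        linarith
      simpa [FormalMultilinearSeries.ofScalars_apply_eq, mul_comm] using h y hy'
  exact (FormalMultilinearSeries.ofScalars_series_eq_zero ℂ).1 hp.hasFPowerSeriesAt.eq_zero

/-! ### Reproducing kernel Hilbert spaces from feature maps -/

section FeatureMap

open ContinuousLinearMap

variable {X W E J : Type*} [NormedAddCommGroup W] [InnerProductSpace ℂ W] [CompleteSpace W]
  [NormedAddCommGroup E] [InnerProductSpace ℂ E] [CompleteSpace E]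

/-- `ψ` is a feature map of the kernel `K` with values in the Hilbert space `E`: it factors the
kernel as `K x y = (ψ x)† ∘ ψ y`. -/
def IsFeatureMap (K : Matrix X X (W →L[ℂ] W)) (ψ : X → W →L[ℂ] E) : Prop :=
  ∀ x y v w, inner ℂ (ψ x v) (ψ y w) = inner ℂ v (K x y w)

lemma IsFeatureMap.eq_comp {K : Matrix X X (W →L[ℂ] W)} {ψ : X → W →L[ℂ] E}
    (h : IsFeatureMap K ψ) (x y : X) : K x y = adjoint (ψ x) ∘L ψ y := by
  ext w
  refine ext_inner_left ℂ fun v => ?_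
  rw [← h x y v w, comp_apply, adjoint_inner_right]

lemma IsFeatureMap.posSemidef {K : Matrix X X (W →L[ℂ] W)} {ψ : X → W →L[ℂ] E}
    (h : IsFeatureMap K ψ) : K.PosSemidef := by
  have htfae := (RKHS.posSemidef_tfae (K := K)).out 0 2
  refine htfae.2 ⟨?_, fun f => ?_⟩
  · ext1 x y
    rw [Matrix.conjTranspose_apply, h.eq_comp, h.eq_comp, star_eq_adjoint, adjoint_comp,
      adjoint_adjoint]
  · have : (f.sum fun x w => f.sum fun x' w' => inner ℂ (K x' x w) w') =
        inner ℂ (f.sum fun x w => ψ x w) (f.sum fun x w => ψ x w) := by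
      simp only [Finsupp.sum, sum_inner, inner_sum]
      rw [Finset.sum_comm]
      refine Finset.sum_congr rfl fun x _ => Finset.sum_congr rfl fun y _ => ?_
      rw [← inner_conj_symm, ← h, inner_conj_symm]
    rw [this]
    exact inner_self_nonneg

variable [NormedAddCommGroup J] [InnerProductSpace ℂ J] [CompleteSpace J] [RKHS ℂ J X W]

/-- A feature map `ψ` of the kernel of `J` presents `J` as a quotient of the feature space `E`:
`e ↦ (x ↦ (ψ x)† e)` is a coisometry of `E` onto `J`. -/
lemma IsFeatureMap.exists_coisometry {ψ : X → W →L[ℂ] E} (h : IsFeatureMap (RKHS.kernel J) ψ) :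
    ∃ V : E →L[ℂ] J, (∀ e x, V e x = adjoint (ψ x) e) ∧ V ∘L adjoint V = .id ℂ J := by
  let T : (X × W →₀ ℂ) →ₗ[ℂ] J := Finsupp.linearCombination ℂ fun p => RKHS.kerFun J p.1 p.2
  let T' : (X × W →₀ ℂ) →ₗ[ℂ] E := Finsupp.linearCombination ℂ fun p => ψ p.1 p.2
  have hT : DenseRange T := by
    have h1 : Set.range T = (Submodule.span ℂ {RKHS.kerFun J x v | (x) (v)} : Submodule ℂ J) := by
      rw [← LinearMap.coe_range, Finsupp.range_linearCombination]
      congr 2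
      ext y
      simp [Set.mem_range, Prod.exists]
    rw [DenseRange, h1, Submodule.dense_iff_topologicalClosure_eq_top]
    exact RKHS.kerFun_dense J
  have hin (f g) : inner ℂ (T' f) (T' g) = inner ℂ (T f) (T g) := by
    simp only [T, T', Finsupp.linearCombination_apply, Finsupp.sum, sum_inner, inner_sum,
      inner_smul_left, inner_smul_right]
    refine Finset.sum_congr rfl fun x _ =>
      congrArg _ (Finset.sum_congr rfl fun y _ => congrArg _ ?_)
    rw [h, ← RKHS.kerFun_apply, RKHS.kerFun_inner]
  have hnorm (f) : ‖T' f‖ = ‖T f‖ := by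
    rw [← sq_eq_sq₀ (norm_nonneg _) (norm_nonneg _), ← inner_self_eq_norm_sq (𝕜 := ℂ), hin,
      inner_self_eq_norm_sq]
  have hC : ∃ C : ℝ, ∀ f, ‖T' f‖ ≤ C * ‖T f‖ := ⟨1, fun f => by rw [hnorm, one_mul]⟩
  let I : J →L[ℂ] E := T'.extendOfNorm T
  have hI (f) : I (T f) = T' f := LinearMap.extendOfNorm_eq hT hC f
  have hI1 (x v) : I (RKHS.kerFun J x v) = ψ x v := by
    have := hI (Finsupp.single (x, v) 1)
    simpa [T, T'] using this
  refine ⟨adjoint I, fun e x => ?_, ?_⟩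
  · refine ext_inner_left ℂ fun v => ?_
    rw [← RKHS.kerFun_inner, adjoint_inner_right, adjoint_inner_right, hI1]
  · rw [adjoint_adjoint]
    refine ContinuousLinearMap.ext fun y => ?_
    refine hT.induction_on (p := fun y => (adjoint I ∘L I) y = y) y
      (isClosed_eq (by fun_prop) (by fun_prop)) fun f => ?_
    refine hT.eq_of_inner_left ℂ fun g => ?_
    rw [comp_apply, adjoint_inner_left, hI, hI, hin]

end FeatureMap

/-! ### The Taylor expansion of the kernels -/

section Expansion

variable {α β : ℝ}

lemma summable_negBinom_jet (hβ : 0 < β) (i j : ℕ) {r s : ℝ} (hr0 : 0 ≤ r) (hr1 : r < 1)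
    (hs0 : 0 ≤ s) (hs1 : s < 1) :
    Summable fun l : ℕ => negBinom β l * ((l.descFactorial j : ℝ) * s ^ (l - j)) *
      ((l.descFactorial i : ℝ) * r ^ (l - i)) := by
  have h1 := summable_mul_descFactorial (e := id) (fun l => (negBinom_pos hβ l).le)
    (fun r h0 h1 => summable_negBinom hβ h0 h1) j hs0 hs1
  have hpos (l : ℕ) : 0 ≤ negBinom β l * ((l.descFactorial j : ℝ) * s ^ (l - j)) := by
    have := (negBinom_pos hβ l).le
    positivity
  refine summable_mul_descFactorial (e := id) hpos (fun r h0 hr => ?_) i hr0 hr1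
  exact Summable.of_nonneg_of_le (fun l => mul_nonneg (hpos l) (by positivity))
    (fun l => mul_le_of_le_one_right (hpos l) (pow_le_one₀ h0 hr.le)) h1

/-- The Taylor series of `∂_ζ^i ∂_η^j (1 - ζ η) ^ (-β)`. -/
lemma hasSum_iteratedDeriv_iteratedDeriv (hβ : 0 < β) (i j : ℕ) {z w : ℂ} (hz : ‖z‖ < 1)
    (hw : ‖w‖ < 1) :
    HasSum (fun l : ℕ => (negBinom β l : ℂ) * ((l.descFactorial j : ℂ) * w ^ (l - j)) *
        ((l.descFactorial i : ℂ) * z ^ (l - i)))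
      (iteratedDeriv i
        (fun ζ : ℂ => iteratedDeriv j (fun η : ℂ => (1 - ζ * η) ^ (-(β : ℂ))) w) z) := by
  have inner_sum {ζ : ℂ} (hζ : ‖ζ‖ < 1) :
      iteratedDeriv j (fun η : ℂ => (1 - ζ * η) ^ (-(β : ℂ))) w =
        ∑' l : ℕ, (negBinom β l : ℂ) * ((l.descFactorial j : ℂ) * w ^ (l - j)) * ζ ^ l := by
    have h := hasSum_iteratedDeriv (c := fun l : ℕ => (negBinom β l : ℂ) * ζ ^ l) (e := id)
      (fun r h0 h1 => by
        refine Summable.of_nonneg_of_le (fun l => by positivity) (fun l => ?_)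
          (summable_negBinom hβ h0 h1)
        have := (negBinom_pos hβ l)
        simp only [norm_mul, Complex.norm_real, norm_pow, Real.norm_eq_abs, abs_of_pos this, id]
        rw [mul_right_comm]
        exact mul_le_of_le_one_right (by positivity) (pow_le_one₀ (norm_nonneg _) hζ.le)) j hw
    have h' := h.tsum_eq
    simp only [id] at h'
    have hcomm : (∑' l : ℕ, (negBinom β l : ℂ) * ((l.descFactorial j : ℂ) * w ^ (l - j)) * ζ ^ l) =
        ∑' l : ℕ, (negBinom β l : ℂ) * ζ ^ l * ((l.descFactorial j : ℂ) * w ^ (l - j)) :=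
      tsum_congr fun l => by ring
    rw [hcomm, h']
    · refine Filter.EventuallyEq.iteratedDeriv_eq _ ?_
      filter_upwards [Metric.isOpen_ball.mem_nhds (mem_ball_zero_iff.2 hw)] with η hη
      have hη := mem_ball_zero_iff.1 hη
      rw [← (hasSum_negBinom β (z := ζ * η) ?_).tsum_eq]
      · exact tsum_congr fun l => by ring
      · rw [norm_mul]
        exact mul_lt_one_of_nonneg_of_lt_one_left (norm_nonneg _) hζ hη.le
  have h := hasSum_iteratedDeriv
    (c := fun l : ℕ => (negBinom β l : ℂ) * ((l.descFactorial j : ℂ) * w ^ (l - j))) (e := id)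
    (fun r h0 h1 => by
      refine (summable_negBinom_jet hβ 0 j h0 h1 (norm_nonneg w) hw).congr fun l => ?_
      simp [abs_of_pos (negBinom_pos hβ l)]) i hz
  convert! h using 1
  refine Filter.EventuallyEq.iteratedDeriv_eq _ ?_
  filter_upwards [Metric.isOpen_ball.mem_nhds (mem_ball_zero_iff.2 hz)] with ζ hζ
  exact inner_sum (mem_ball_zero_iff.1 hζ)

lemma hasSum_mul_prod {f g : ℕ → ℂ} {a b : ℂ} (hf : HasSum f a) (hg : HasSum g b) :
    HasSum (fun p : ℕ × ℕ => f p.1 * g p.2) (a * b) :=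
  hf.mul hg (summable_mul_of_summable_norm hf.summable.norm hg.summable.norm)

lemma hasSum_bidiscFun (z w : Disc × Disc) :
    HasSum (fun p : ℕ × ℕ => ((negBinom α p.1 : ℂ) * ((z.1 : ℂ) * conj (w.1 : ℂ)) ^ p.1) *
      ((negBinom β p.2 : ℂ) * ((z.2 : ℂ) * conj (w.2 : ℂ)) ^ p.2))
      (bidiscFun α β ((z.1 : ℂ), (z.2 : ℂ)) ((w.1 : ℂ), (w.2 : ℂ))) := by
  have hd (z w : Disc) : ‖(z : ℂ) * conj (w : ℂ)‖ < 1 := by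
    rw [norm_mul, RCLike.norm_conj]
    exact mul_lt_one_of_nonneg_of_lt_one_left (norm_nonneg _) z.norm_lt_one w.norm_lt_one.le
  have h1 := hasSum_negBinom α (hd z.1 w.1)
  have h2 := hasSum_negBinom β (hd z.2 w.2)
  rw [bidiscFun]
  have h3 := hasSum_mul_prod h1 h2
  beta_reduce at h3
  exact h3

lemma hasSum_jetEntry (hβ : 0 < β) (i j : ℕ) (z w : Disc) :
    HasSum (fun p : ℕ × ℕ => ((negBinom α p.1 : ℂ) * ((z : ℂ) * conj (w : ℂ)) ^ p.1) *
      ((negBinom β p.2 : ℂ) * ((p.2.descFactorial j : ℂ) * conj (w : ℂ) ^ (p.2 - j)) *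
        ((p.2.descFactorial i : ℂ) * (z : ℂ) ^ (p.2 - i))))
      (jetEntry α β i j z w) := by
  have hd : ‖(z : ℂ) * conj (w : ℂ)‖ < 1 := by
    rw [norm_mul, RCLike.norm_conj]
    exact mul_lt_one_of_nonneg_of_lt_one_left (norm_nonneg _) z.norm_lt_one w.norm_lt_one.le
  have h1 := hasSum_negBinom α hd
  have h2 := hasSum_iteratedDeriv_iteratedDeriv hβ i j z.norm_lt_one
    (w := conj (w : ℂ)) (by simpa using w.norm_lt_one)
  have he : jetEntry α β i j z w = (1 - (z : ℂ) * conj (w : ℂ)) ^ (-(α : ℂ)) *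
      iteratedDeriv i (fun ζ : ℂ =>
        iteratedDeriv j (fun η : ℂ => (1 - ζ * η) ^ (-(β : ℂ))) (conj (w : ℂ))) z := by
    simp only [jetEntry, bidiscFun, Complex.conj_conj, iteratedDeriv_const_mul_field]
  rw [he]
  have h3 := hasSum_mul_prod h1 h2
  beta_reduce at h3
  exact h3

end Expansion

/-! ### The feature space `ℓ²(ℕ × ℕ)` -/

/-- The Hilbert space `ℓ²(ℕ × ℕ)`; the basis vector at `(k, l)` stands for the normalised monomial
`z₁^k z₂^l` of the space with kernel `B`. -/
abbrev FeatureSpace : Type := lp (fun _ : ℕ × ℕ => ℂ) 2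

/-- The reciprocal of the norm of `z₁^k z₂^l` in the space with kernel `B`. -/
noncomputable def monomialWeight (α β : ℝ) (p : ℕ × ℕ) : ℝ :=
  √(negBinom α p.1 * negBinom β p.2)

/-- `∂₂^i` of the normalised monomial with exponents `p`, at the point `z`. -/
noncomputable def jetMonomial (α β : ℝ) (i : ℕ) (z : Disc × Disc) (p : ℕ × ℕ) : ℂ :=
  monomialWeight α β p * (z.1 : ℂ) ^ p.1 * ((p.2.descFactorial i : ℂ) * (z.2 : ℂ) ^ (p.2 - i))

section Features

variable {α β : ℝ}

lemma monomialWeight_pos (hα : 0 < α) (hβ : 0 < β) (p : ℕ × ℕ) : 0 < monomialWeight α β p :=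
  Real.sqrt_pos.2 (mul_pos (negBinom_pos hα _) (negBinom_pos hβ _))

lemma monomialWeight_mul_self (hα : 0 < α) (hβ : 0 < β) (p : ℕ × ℕ) :
    monomialWeight α β p * monomialWeight α β p = negBinom α p.1 * negBinom β p.2 :=
  Real.mul_self_sqrt (mul_pos (negBinom_pos hα _) (negBinom_pos hβ _)).le

lemma memℓp_jetMonomial (hα : 0 < α) (hβ : 0 < β) (i : ℕ) (z : Disc × Disc) :
    Memℓp (fun p => conj (jetMonomial α β i z p)) 2 := by
  refine memℓp_gen ?_
  have h1 := summable_negBinom hα (r := ‖(z.1 : ℂ)‖ * ‖(z.1 : ℂ)‖) (by positivity)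
    (mul_lt_one_of_nonneg_of_lt_one_left (norm_nonneg _) z.1.norm_lt_one z.1.norm_lt_one.le)
  have h2 := summable_negBinom_jet hβ i i (norm_nonneg (z.2 : ℂ)) z.2.norm_lt_one
    (norm_nonneg (z.2 : ℂ)) z.2.norm_lt_one
  refine (h1.mul_of_nonneg h2 (fun k => ?_) (fun l => ?_)).congr fun p => ?_
  · have := (negBinom_pos hα k).le
    positivity
  · have := (negBinom_pos hβ l).le
    positivity
  · have := monomialWeight_mul_self hα hβ p
    simp only [jetMonomial, RCLike.norm_conj, norm_mul, norm_pow, Complex.norm_real,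
      Complex.norm_natCast, Real.norm_eq_abs, abs_of_pos (monomialWeight_pos hα hβ p),
      ENNReal.toReal_ofNat, Real.rpow_ofNat]
    linear_combination (-(‖(z.1 : ℂ)‖ ^ p.1 *
      ((p.2.descFactorial i : ℝ) * ‖(z.2 : ℂ)‖ ^ (p.2 - i))) ^ 2) * this

/-- The vector of `ℓ²(ℕ × ℕ)` that represents the functional `f ↦ ∂₂^i f (z)`. -/
noncomputable def feature (hα : 0 < α) (hβ : 0 < β) (i : ℕ) (z : Disc × Disc) : FeatureSpace :=
  ⟨fun p => conj (jetMonomial α β i z p), memℓp_jetMonomial hα hβ i z⟩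

variable (hα : 0 < α) (hβ : 0 < β)

lemma feature_apply (i : ℕ) (z : Disc × Disc) (p : ℕ × ℕ) :
    feature hα hβ i z p = conj (jetMonomial α β i z p) := rfl

lemma hasSum_inner_feature (i : ℕ) (z : Disc × Disc) (x : FeatureSpace) :
    HasSum (fun p => x p * jetMonomial α β i z p) (inner ℂ (feature hα hβ i z) x) := by
  simpa [feature_apply] using lp.hasSum_inner (𝕜 := ℂ) (feature hα hβ i z) x

lemma inner_feature_feature (i j : ℕ) (z w : Disc × Disc) :
    HasSum (fun p : ℕ × ℕ => ((negBinom α p.1 : ℂ) * ((z.1 : ℂ) * conj (w.1 : ℂ)) ^ p.1) *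
      ((negBinom β p.2 : ℂ) * ((p.2.descFactorial j : ℂ) * conj (w.2 : ℂ) ^ (p.2 - j)) *
        ((p.2.descFactorial i : ℂ) * (z.2 : ℂ) ^ (p.2 - i))))
      (inner ℂ (feature hα hβ i z) (feature hα hβ j w)) := by
  convert! hasSum_inner_feature hα hβ i z (feature hα hβ j w) using 2 with p
  have h : (monomialWeight α β p : ℂ) * monomialWeight α β p = negBinom α p.1 * negBinom β p.2 := by
    exact_mod_cast monomialWeight_mul_self hα hβ p
  simp only [feature_apply, jetMonomial, map_mul, map_pow, Complex.conj_ofReal, map_natCast,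
    mul_pow]
  linear_combination (-(z.1 : ℂ) ^ p.1 * conj (w.1 : ℂ) ^ p.1 *
    ((p.2.descFactorial j : ℂ) * conj (w.2 : ℂ) ^ (p.2 - j)) *
        ((p.2.descFactorial i : ℂ) * (z.2 : ℂ) ^ (p.2 - i))) * h

/-- Differentiating the function represented by `x` amounts to pairing `x` with the derivative
features. -/
lemma diagDeriv_eq_inner_feature {f : Disc × Disc → ℂ} {x : FeatureSpace}
    (h : ∀ z, f z = inner ℂ (feature hα hβ 0 z) x) (i : ℕ) (z : Disc) :
    diagDeriv i f z = inner ℂ (feature hα hβ i (z, z)) x := by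
  have h0 (w : Disc) : HasSum
      (fun p : ℕ × ℕ => x p * (monomialWeight α β p * (z : ℂ) ^ p.1) * (w : ℂ) ^ p.2) (f (z, w)) := by
    rw [h]
    convert! hasSum_inner_feature hα hβ 0 (z, w) x using 2 with p
    simp [jetMonomial]
    ring
  have key := hasSum_iteratedDeriv
    (c := fun p : ℕ × ℕ => x p * (monomialWeight α β p * (z : ℂ) ^ p.1)) (e := Prod.snd)
    (fun r hr0 hr1 => by
      refine (h0 (Complex.UnitDisc.mk r
        (by simpa [abs_of_nonneg hr0] using hr1))).summable.norm.congr fun p => ?_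
      simp [abs_of_nonneg hr0]) i z.norm_lt_one
  have hx : HasSum (fun p : ℕ × ℕ => x p * (monomialWeight α β p * (z : ℂ) ^ p.1) *
      ((p.2.descFactorial i : ℂ) * (z : ℂ) ^ (p.2 - i))) (inner ℂ (feature hα hβ i (z, z)) x) := by
    convert! hasSum_inner_feature hα hβ i (z, z) x using 2 with p
    simp [jetMonomial]
    ring
  rw [← key.unique hx, diagDeriv]
  refine Filter.EventuallyEq.iteratedDeriv_eq _ ?_
  filter_upwards [Metric.isOpen_ball.mem_nhds (mem_ball_zero_iff.2 z.norm_lt_one)] with w hw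
  have hw : w = ((Complex.UnitDisc.mk w (mem_ball_zero_iff.1 hw) : Disc) : ℂ) := rfl
  rw [hw, Complex.UnitDisc.coe_injective.extend_apply]
  exact (h0 _).tsum_eq.symm

/-- The feature map of the kernel `B`. -/
noncomputable def bidiscFeature (z : Disc × Disc) : ℂ →L[ℂ] FeatureSpace :=
  ContinuousLinearMap.toSpanSingleton ℂ (feature hα hβ 0 z)

/-- The feature map of the jet kernel. -/
noncomputable def jetFeature (n : ℕ) (z : Disc) : Jets n →L[ℂ] FeatureSpace :=
  ∑ i : Fin (n + 1), (EuclideanSpace.proj i).smulRight (feature hα hβ i (z, z))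

lemma isFeatureMap_bidiscKernel : IsFeatureMap (bidiscKernel α β) (bidiscFeature hα hβ) := by
  intro z w u v
  have h : inner ℂ (feature hα hβ 0 z) (feature hα hβ 0 w) =
      bidiscFun α β ((z.1 : ℂ), (z.2 : ℂ)) ((w.1 : ℂ), (w.2 : ℂ)) := by
    refine (inner_feature_feature hα hβ 0 0 z w).unique ?_
    convert! hasSum_bidiscFun z w using 2 with p
    simp only [Nat.descFactorial_zero, Nat.cast_one, one_mul, Nat.sub_zero, mul_pow]
    ring
  simp only [bidiscFeature, bidiscKernel, ContinuousLinearMap.toSpanSingleton_apply,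
    inner_smul_left, inner_smul_right, h, Matrix.of_apply, FunLike.coe_smul, Pi.smul_apply,
    ContinuousLinearMap.id_apply]
  simp
  ring

lemma jetFeature_apply (n : ℕ) (z : Disc) (v : Jets n) :
    jetFeature hα hβ n z v = ∑ i : Fin (n + 1), v i • feature hα hβ i (z, z) := by
  simp [jetFeature]

lemma isFeatureMap_jetKernel (n : ℕ) : IsFeatureMap (jetKernel α β n) (jetFeature hα hβ n) := by
  intro z w u v
  have h (i j : ℕ) : inner ℂ (feature hα hβ i (z, z)) (feature hα hβ j (w, w)) =
      jetEntry α β i j z w :=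
    (inner_feature_feature hα hβ i j (z, z) (w, w)).unique (hasSum_jetEntry hβ i j z w)
  simp only [jetFeature_apply, sum_inner, inner_sum, inner_smul_left, inner_smul_right, h,
    jetKernel, PiLp.inner_apply, Matrix.of_apply]
  simp only [Finset.mul_sum]
  rw [Finset.sum_comm]
  refine Finset.sum_congr rfl fun i _ => ?_
  rw [Matrix.ofLp_toEuclideanCLM, RCLike.inner_apply]
  simp only [Matrix.mulVec, dotProduct, Matrix.of_apply, Finset.sum_mul]
  refine Finset.sum_congr rfl fun j _ => ?_
  ring

lemma adjoint_bidiscFeature_apply (z : Disc × Disc) (x : FeatureSpace) :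
    ContinuousLinearMap.adjoint (bidiscFeature hα hβ z) x = inner ℂ (feature hα hβ 0 z) x := by
  refine ext_inner_left ℂ fun v => ?_
  rw [ContinuousLinearMap.adjoint_inner_right]
  simp [bidiscFeature, inner_smul_left, mul_comm]

lemma adjoint_jetFeature_apply (n : ℕ) (z : Disc) (x : FeatureSpace) (i : Fin (n + 1)) :
    ContinuousLinearMap.adjoint (jetFeature hα hβ n z) x i =
      inner ℂ (feature hα hβ i (z, z)) x := by
  have := ContinuousLinearMap.adjoint_inner_right (jetFeature hα hβ n z)
    (EuclideanSpace.single i 1) x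
  rw [EuclideanSpace.inner_single_left, jetFeature_apply] at this
  simpa [ite_smul] using this

/-! ### The weighted shift -/

/-- Composition with an injection, followed by multiplication by a bounded sequence, is a bounded
operator on `ℓ²`. -/
lemma exists_weighted_composition {ι : Type*} {a : ι → ℂ} {σ : ι → ι} (hσ : Function.Injective σ)
    {C : ℝ} (hC : 0 ≤ C) (ha : ∀ i, ‖a i‖ ≤ C) :
    ∃ B : lp (fun _ : ι => ℂ) 2 →L[ℂ] lp (fun _ : ι => ℂ) 2, ∀ x i, B x i = a i * x (σ i) := by
  have h2 : 0 < (2 : ENNReal).toReal := by norm_num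
  have bound (x : lp (fun _ : ι => ℂ) 2) (s : Finset ι) :
      ∑ i ∈ s, ‖a i * x (σ i)‖ ^ (2 : ENNReal).toReal ≤ (C * ‖x‖) ^ (2 : ENNReal).toReal := by
    have h := lp.sum_rpow_le_norm_rpow h2 x (s.map ⟨σ, hσ⟩)
    rw [Finset.sum_map] at h
    simp only [ENNReal.toReal_ofNat, Real.rpow_ofNat, norm_mul, mul_pow,
      Function.Embedding.coeFn_mk] at h ⊢
    calc ∑ i ∈ s, ‖a i‖ ^ 2 * ‖x (σ i)‖ ^ 2 ≤ ∑ i ∈ s, C ^ 2 * ‖x (σ i)‖ ^ 2 := by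
          gcongr with i
          exact ha i
      _ = C ^ 2 * ∑ i ∈ s, ‖x (σ i)‖ ^ 2 := by rw [Finset.mul_sum]
      _ ≤ _ := by gcongr
  let B : lp (fun _ : ι => ℂ) 2 →ₗ[ℂ] lp (fun _ : ι => ℂ) 2 :=
    { toFun := fun x => ⟨fun i => a i * x (σ i), memℓp_gen' (bound x)⟩
      map_add' := fun x y => by
        ext i
        exact mul_add _ _ _
      map_smul' := fun c x => by
        ext i
        exact mul_left_comm _ _ _ }
  exact ⟨B.mkContinuous C fun x =>
    lp.norm_le_of_forall_sum_le h2 (by positivity) (bound x), fun x i => rfl⟩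

/-- The backward shift in the first index, with the weights that make the derivative features
eigenvectors. -/
lemma exists_backward_shift :
    ∃ B : FeatureSpace →L[ℂ] FeatureSpace,
      ∀ i z, B (feature hα hβ i z) = conj (z.1 : ℂ) • feature hα hβ i z := by
  have hq (k : ℕ) : negBinom α k / negBinom α (k + 1) ≤ 1 + 1 / α := by
    have h1 := negBinom_succ α k
    have h2 := negBinom_pos hα k
    have h3 := negBinom_pos hα (k + 1)
    have hk : (0 : ℝ) ≤ k := k.cast_nonneg
    rw [div_le_iff₀ h3]
    have h4 : negBinom α k = negBinom α (k + 1) * ((k + 1) / (α + k)) := by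
      field_simp
      linarith
    rw [h4, mul_comm]
    gcongr
    rw [div_le_iff₀ (by positivity)]
    have : (1 + 1 / α) * (α + k) = α + k + 1 + k / α := by field_simp; ring
    have : 0 ≤ k / α := by positivity
    linarith
  obtain ⟨B, hB⟩ := exists_weighted_composition (ι := ℕ × ℕ)
    (a := fun p => (√(negBinom α p.1 / negBinom α (p.1 + 1)) : ℂ))
    (σ := fun p => (p.1 + 1, p.2)) (fun p q h => by simpa [Prod.ext_iff] using h)
    (C := √(1 + 1 / α)) (Real.sqrt_nonneg _) (fun p => by
      rw [Complex.norm_real, Real.norm_of_nonneg (Real.sqrt_nonneg _)]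
      exact Real.sqrt_le_sqrt (hq p.1))
  refine ⟨B, fun i z => ?_⟩
  ext p
  have hw : √(negBinom α p.1 / negBinom α (p.1 + 1)) * monomialWeight α β (p.1 + 1, p.2) =
      monomialWeight α β p := by
    have h2 := negBinom_pos hα p.1
    have h3 := negBinom_pos hα (p.1 + 1)
    rw [monomialWeight, monomialWeight, ← Real.sqrt_mul (by positivity)]
    congr 1
    field_simp
  have hw' : ((√(negBinom α p.1 / negBinom α (p.1 + 1)) : ℝ) : ℂ) *
      (monomialWeight α β (p.1 + 1, p.2) : ℂ) = monomialWeight α β p := by exact_mod_cast hw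
  rw [hB]
  simp only [lp.coeFn_smul, Pi.smul_apply, feature_apply, jetMonomial, map_mul, map_pow,
    Complex.conj_ofReal, smul_eq_mul, ← hw']
  ring

end Features

/-! ### Irreducibility -/

section Irreducible

open ContinuousLinearMap Finset

variable {J : Type*} [NormedAddCommGroup J] [InnerProductSpace ℂ J]

/-- The combination `∑_{k + m = d} a_k b_m L_l(m) u_{k,m}`. For the jets `u` of the monomials it is
biorthogonal to the `u_{k,l}`. -/
noncomputable def dualVector (a b : ℕ → ℝ) (L : ℕ → ℕ → ℝ) (u : ℕ → ℕ → J) (d l : ℕ) : J :=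
  ∑ m ∈ range (d + 1), ((a (d - m) * b m * L l m : ℝ) : ℂ) • u (d - m) m

/-- The matrix of the dual vectors of degree `d` with respect to the `u_{d - i, i}`, `i ≤ n`. -/
def dualGram (a b : ℕ → ℝ) (L : ℕ → ℕ → ℝ) (d l i : ℕ) : ℝ :=
  ∑ m ∈ range (d + 1), a (d - m) * b m * L l m * L i m

lemma dualGram_symm (a b : ℕ → ℝ) (L : ℕ → ℕ → ℝ) (d l i : ℕ) : dualGram a b L d l i = dualGram a b L d i l :=
  sum_congr rfl fun m _ => by ring

/-- The algebraic properties of the jets `u_{k,l}` of the monomials `z₁^k z₂^l` that force the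
multiplication operator `M` to be irreducible. The `L_i` play the role of the Lagrange basis
polynomials for the nodes `0, …, n`. -/
structure IsJetSystem (n : ℕ) (a b : ℕ → ℝ) (L : ℕ → ℕ → ℝ) (M : J →L[ℂ] J)
    (u : ℕ → ℕ → J) : Prop where
  pos_left : ∀ k, 0 < a k
  pos_right : ∀ k, 0 < b k
  node : ∀ i ≤ n, ∀ j ≤ n, L i j = if i = j then 1 else 0
  node_succ : ∀ i ≤ n, L i (n + 1) ≠ 0
  map : ∀ k l, M (u k l) = u (k + 1) l
  total : ∀ x, (∀ k l, inner ℂ (u k l) x = 0) → x = 0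
  interp : ∀ k l, u k l = ∑ i ∈ range (n + 1), (L i l : ℂ) • u (k + l - i) i
  inner_dual : ∀ d, ∀ l ≤ n, ∀ k j, inner ℂ (dualVector a b L u d l) (u k j) =
    if k + j = d then (L l j : ℂ) else 0

namespace IsJetSystem

variable {n : ℕ} {a b : ℕ → ℝ} {L : ℕ → ℕ → ℝ} {M : J →L[ℂ] J} {u : ℕ → ℕ → J}
  (h : IsJetSystem n a b L M u)

include h

lemma dualVector_self {l : ℕ} (hl : l ≤ n) :
    dualVector a b L u l l = ((a 0 * b l : ℝ) : ℂ) • u 0 l := by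
  rw [dualVector, sum_eq_single l]
  · simp [h.node l hl l hl]
  · intro m hm hml
    have : m ≤ l := by simpa [Nat.lt_succ_iff] using hm
    rw [h.node l hl m (this.trans hl), if_neg (Ne.symm hml)]
    simp
  · simp

lemma inner_zero_map {l : ℕ} (hl : l ≤ n) (k j : ℕ) : inner ℂ (u 0 l) (u (k + 1) j) = 0 := by
  have h1 := h.inner_dual l l hl (k + 1) j
  have hc : ((a 0 * b l : ℝ) : ℂ) ≠ 0 :=
    Complex.ofReal_ne_zero.2 (mul_pos (h.pos_left 0) (h.pos_right l)).ne'
  have h2 : (if k + 1 + j = l then (L l j : ℂ) else 0) = 0 := by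
    split_ifs with hj
    · rw [h.node l hl j (by omega), if_neg (by omega)]
      simp
    · rfl
  rw [h2, h.dualVector_self hl, inner_smul_left] at h1
  exact (mul_eq_zero.1 h1).resolve_left (by simpa using hc)

/-- In degree `n + 1` every entry is nonzero: the terms `m ≤ n` only meet the diagonal, where they
are nonnegative, and the term `m = n + 1` meets all entries. -/
lemma dualGram_succ_ne_zero {l i : ℕ} (hl : l ≤ n) (hi : i ≤ n) :
    dualGram a b L (n + 1) l i ≠ 0 := by
  have hlast : a (n + 1 - (n + 1)) * b (n + 1) * L l (n + 1) * L i (n + 1) ≠ 0 :=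
    mul_ne_zero (mul_ne_zero (mul_pos (h.pos_left _) (h.pos_right _)).ne' (h.node_succ l hl))
      (h.node_succ i hi)
  rw [dualGram, sum_range_succ]
  by_cases hli : l = i
  · subst hli
    refine ne_of_gt (add_pos_of_nonneg_of_pos (sum_nonneg fun m _ => ?_) ?_)
    · rw [mul_assoc]
      exact mul_nonneg (mul_pos (h.pos_left _) (h.pos_right _)).le (mul_self_nonneg _)
    · refine lt_of_le_of_ne ?_ hlast.symm
      rw [mul_assoc]
      exact mul_nonneg (mul_pos (h.pos_left _) (h.pos_right _)).le (mul_self_nonneg _)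
  · rw [sum_eq_zero, zero_add]
    · exact hlast
    · intro m hm
      have hm : m ≤ n := by simpa [Nat.lt_succ_iff] using hm
      rw [h.node l hl m hm, h.node i hi m hm]
      split_ifs <;> simp_all

lemma inner_dualVector_map {P : J →L[ℂ] J} {Y : ℕ → ℕ → ℂ}
    (hY : ∀ k, ∀ l ≤ n, P (u k l) = ∑ j ∈ range (n + 1), Y j l • u k j)
    (d l d' : ℕ) {m : ℕ} (hm : m ≤ n) :
    inner ℂ (dualVector a b L u d' m) (P (dualVector a b L u d l)) =
      ∑ i ∈ range (n + 1), (dualGram a b L d l i : ℂ) * if d - i + m = d' then Y m i else 0 := by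
  have h1 (k i : ℕ) : inner ℂ (dualVector a b L u d' m) (∑ j ∈ range (n + 1), Y j i • u k j) =
      if k + m = d' then Y m i else 0 := by
    rw [inner_sum, sum_eq_single m]
    · rw [inner_smul_right, h.inner_dual d' m hm, h.node m hm m hm]
      simp
    · intro j hj hjm
      have hj : j ≤ n := by simpa [Nat.lt_succ_iff] using hj
      rw [inner_smul_right, h.inner_dual d' m hm, h.node m hm j hj, if_neg (Ne.symm hjm)]
      simp
    · intro hm'
      exact absurd (mem_range.2 (Nat.lt_succ_of_le hm)) hm'
  have h2 {k : ℕ} (hk : k ∈ range (d + 1)) : P (u (d - k) k) =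
      ∑ i ∈ range (n + 1), (L i k : ℂ) • ∑ j ∈ range (n + 1), Y j i • u (d - i) j := by
    have hk : d - k + k = d := by
      have := mem_range.1 hk
      omega
    rw [h.interp (d - k) k, hk, map_sum]
    refine sum_congr rfl fun i hi => ?_
    rw [map_smul, hY _ i (by simpa [Nat.lt_succ_iff] using hi)]
  have h3 : P (dualVector a b L u d l) = ∑ k ∈ range (d + 1),
      ((a (d - k) * b k * L l k : ℝ) : ℂ) • P (u (d - k) k) := by
    simp only [dualVector, map_sum, map_smul]
  rw [h3, inner_sum]
  simp only [dualGram, Complex.ofReal_sum, sum_mul]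
  rw [sum_comm]
  refine sum_congr rfl fun k hk => ?_
  rw [inner_smul_right, h2 hk, inner_sum, mul_sum]
  refine sum_congr rfl fun i _ => ?_
  rw [inner_smul_right, h1]
  push_cast
  ring

variable [CompleteSpace J]

lemma adjoint_map_zero {l : ℕ} (hl : l ≤ n) : adjoint M (u 0 l) = 0 := by
  refine h.total _ fun k j => ?_
  rw [adjoint_inner_right, h.map, ← inner_conj_symm, h.inner_zero_map hl, map_zero]

/-- The kernel of `M†` is spanned by the jets of `1, z₂, …, z₂^n`. -/
lemma mem_span_of_adjoint_eq_zero {x : J} (hx : adjoint M x = 0) :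
    x ∈ Submodule.span ℂ (u 0 '' (range (n + 1) : Finset ℕ)) := by
  set W := Submodule.span ℂ (u 0 '' (range (n + 1) : Finset ℕ)) with hW
  have : FiniteDimensional ℂ W :=
    FiniteDimensional.span_of_finite ℂ ((range (n + 1)).finite_toSet.image _)
  have hWker : W ≤ LinearMap.ker (adjoint M : J →L[ℂ] J).toLinearMap := by
    rw [hW, Submodule.span_le]
    rintro _ ⟨l, hl, rfl⟩
    exact h.adjoint_map_zero (by simpa [Nat.lt_succ_iff] using hl)
  have hy : adjoint M (x - W.starProjection x) = 0 := by
    rw [map_sub, hx, zero_sub, neg_eq_zero]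
    exact hWker (W.starProjection_apply_mem x)
  have hsucc (k l : ℕ) : inner ℂ (u (k + 1) l) (x - W.starProjection x) = 0 := by
    rw [← h.map, ← adjoint_inner_right, hy, inner_zero_right]
  have hzero {l : ℕ} (hl : l ≤ n) : inner ℂ (u 0 l) (x - W.starProjection x) = 0 :=
    W.sub_starProjection_mem_orthogonal x _
      (Submodule.subset_span ⟨l, by simpa [Nat.lt_succ_iff] using hl, rfl⟩)
  have key : x - W.starProjection x = 0 := by
    refine h.total _ fun k l => ?_
    rcases k with _ | k
    · rcases le_or_gt l n with hl | hl
      · exact hzero hl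
      · rw [h.interp, sum_inner]
        refine sum_eq_zero fun i hi => ?_
        have hi : i ≤ n := by simpa [Nat.lt_succ_iff] using hi
        obtain ⟨m, hm⟩ : ∃ m, 0 + l - i = m + 1 := ⟨l - i - 1, by omega⟩
        rw [inner_smul_left, hm, hsucc, mul_zero]
    · exact hsucc k l
  rw [sub_eq_zero.1 key]
  exact W.starProjection_apply_mem x

/-- A bounded operator commuting with `M` and `M†` acts on the jets through a fixed
`(n + 1) × (n + 1)` matrix. -/
lemma exists_matrix {P : J →L[ℂ] J} (hPM : ∀ x, P (M x) = M (P x))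
    (hPM' : ∀ x, P (adjoint M x) = adjoint M (P x)) :
    ∃ Y : ℕ → ℕ → ℂ, ∀ k, ∀ l ≤ n, P (u k l) = ∑ j ∈ range (n + 1), Y j l • u k j := by
  have h0 : ∀ l : ℕ, ∃ c : ℕ → ℂ, l ≤ n → P (u 0 l) = ∑ j ∈ range (n + 1), c j • u 0 j := by
    intro l
    by_cases hl : l ≤ n
    · have := h.mem_span_of_adjoint_eq_zero (x := P (u 0 l)) (by
        rw [← hPM', h.adjoint_map_zero hl, map_zero])
      rw [Submodule.mem_span_image_finset_iff_exists_fun'] at this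
      obtain ⟨c, hc⟩ := this
      exact ⟨c, fun _ => hc.symm⟩
    · exact ⟨0, fun hl' => absurd hl' hl⟩
  choose Y hY using h0
  refine ⟨fun j l => Y l j, fun k l hl => ?_⟩
  induction k with
  | zero => exact hY l hl
  | succ k ih => rw [← h.map, hPM, ih, map_sum]; simp [h.map]

/-- A self-adjoint operator commuting with `M` is a scalar. Its matrix `Y` is determined by
comparing the pairings of the dual vectors of degree `n + 1` with those of degree `d'`: the pairing
of degrees `(n + 1, d')` involves one entry of `Y` only, and for the extreme indices `l = n`
(resp. `l = 0`) the mirrored pairing vanishes for reasons of degree. -/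
lemma exists_eq_smul {P : J →L[ℂ] J} (hPM : ∀ x, P (M x) = M (P x))
    (hPM' : ∀ x, P (adjoint M x) = adjoint M (P x))
    (hP : ∀ x y, inner ℂ (P x) y = inner ℂ x (P y)) : ∃ c : ℂ, ∀ x, P x = c • x := by
  obtain ⟨Y, hY⟩ := h.exists_matrix hPM hPM'
  have pair (l d' : ℕ) {s m : ℕ} (hs : s ≤ n) (hm : m ≤ n) (hd : n + 1 - s + m = d') :
      inner ℂ (dualVector a b L u d' m) (P (dualVector a b L u (n + 1) l)) =
        dualGram a b L (n + 1) l s * Y m s := by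
    rw [h.inner_dualVector_map hY (n + 1) l d' hm, sum_eq_single s]
    · rw [if_pos hd]
    · intro i hi his
      have hi := mem_range.1 hi
      rw [if_neg (by omega), mul_zero]
    · intro hs'
      exact absurd (mem_range.2 (Nat.lt_succ_of_le hs)) hs'
  have mirror (l d' m : ℕ) :
      inner ℂ (dualVector a b L u d' m) (P (dualVector a b L u (n + 1) l)) =
        conj (inner ℂ (dualVector a b L u (n + 1) l) (P (dualVector a b L u d' m))) := by
    rw [inner_conj_symm, hP]
  have off {s m : ℕ} (hs : s ≤ n) (hm : m ≤ n) (hsm : m ≠ s) : Y m s = 0 := by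
    -- The index `l` whose mirrored pairing involves no entry of `Y`.
    obtain ⟨l, hl, hzero⟩ : ∃ l ≤ n, ∀ i ∈ range (n + 1), n + 1 - s + m - i + l ≠ n + 1 := by
      rcases lt_or_gt_of_ne hsm with hlt | hlt
      · exact ⟨0, Nat.zero_le n, fun i _ => by omega⟩
      · exact ⟨n, le_rfl, fun i hi => by have := mem_range.1 hi; omega⟩
    have h1 := mirror l (n + 1 - s + m) m
    rw [pair l _ hs hm rfl, h.inner_dualVector_map hY _ m (n + 1) hl, sum_eq_zero, map_zero] at h1
    · exact (mul_eq_zero.1 h1).resolve_left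
        (Complex.ofReal_ne_zero.2 (h.dualGram_succ_ne_zero hl hs))
    · intro i hi
      rw [if_neg (hzero i hi), mul_zero]
  have diag {l m : ℕ} (hl : l ≤ n) (hm : m ≤ n) : Y m m = conj (Y l l) := by
    have h1 := mirror l (n + 1) m
    rw [pair l _ hm hm (by omega), pair m _ hl hl (by omega), map_mul, Complex.conj_ofReal,
      dualGram_symm] at h1
    exact mul_left_cancel₀ (Complex.ofReal_ne_zero.2 (h.dualGram_succ_ne_zero hm hl)) h1
  have hYc {m : ℕ} (hm : m ≤ n) : Y m m = Y 0 0 := by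
    rw [diag (Nat.zero_le n) hm, ← diag (Nat.zero_le n) (Nat.zero_le n)]
  have hu0 (k : ℕ) {l : ℕ} (hl : l ≤ n) : P (u k l) = Y 0 0 • u k l := by
    rw [hY k l hl, sum_eq_single l]
    · rw [hYc hl]
    · intro j hj hjl
      rw [off hl (by simpa [Nat.lt_succ_iff] using hj) hjl, zero_smul]
    · intro hl'
      exact absurd (mem_range.2 (Nat.lt_succ_of_le hl)) hl'
  have hu (k l : ℕ) : P (u k l) = Y 0 0 • u k l := by
    rw [h.interp k l, map_sum, smul_sum]
    refine sum_congr rfl fun i hi => ?_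
    rw [map_smul, hu0 _ (by simpa [Nat.lt_succ_iff] using hi), smul_comm]
  refine ⟨Y 0 0, fun x => sub_eq_zero.1 (h.total _ fun k l => ?_)⟩
  rw [inner_sub_right, ← hP, hu, inner_smul_left, inner_smul_right,
    ← diag (Nat.zero_le n) (Nat.zero_le n), sub_self]

theorem isIrreducibleOperator : IsIrreducibleOperator M := by
  refine ⟨⟨u 0 0, 0, fun h0 => ?_⟩, fun S hS hM hM' => ?_⟩
  · have := h.inner_dual 0 0 (Nat.zero_le n) 0 0
    rw [h0, inner_zero_right, h.node 0 (Nat.zero_le n) 0 (Nat.zero_le n)] at this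
    simp at this
  have : CompleteSpace S := hS.completeSpace_coe
  have comm {T : J →L[ℂ] J} (h1 : ∀ x ∈ S, T x ∈ S) (h2 : ∀ x ∈ S, adjoint T x ∈ S) (x : J) :
      S.starProjection (T x) = T (S.starProjection x) := by
    refine Submodule.eq_starProjection_of_mem_of_inner_eq_zero
      (h1 _ (S.starProjection_apply_mem x)) fun w hw => ?_
    rw [← map_sub, ← adjoint_inner_right]
    exact S.starProjection_inner_eq_zero x _ (h2 w hw)
  obtain ⟨c, hc⟩ := h.exists_eq_smul (comm hM hM') (comm hM' (by simpa using hM))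
    S.inner_starProjection_left_eq_right
  by_cases hc0 : c = 0
  · left
    refine (Submodule.eq_bot_iff S).2 fun x hx => ?_
    rw [← S.starProjection_eq_self_iff.2 hx, hc, hc0, zero_smul]
  · right
    refine (Submodule.eq_top_iff').2 fun x => ?_
    rw [← inv_smul_smul₀ hc0 x, ← hc]
    exact S.smul_mem _ (S.starProjection_apply_mem x)

end IsJetSystem

end Irreducible

/-! ### Coisometries -/

section Coisometry

open ContinuousLinearMap

variable {H J : Type*} [NormedAddCommGroup H] [InnerProductSpace ℂ H] [CompleteSpace H]
  [NormedAddCommGroup J] [InnerProductSpace ℂ J] [CompleteSpace J]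

lemma apply_adjoint_apply {V : H →L[ℂ] J} (hV : V ∘L adjoint V = .id ℂ J) (g : J) :
    V (adjoint V g) = g :=
  DFunLike.congr_fun hV g

lemma adjoint_apply_apply_of_mem {V : H →L[ℂ] J} (hV : V ∘L adjoint V = .id ℂ J) {h : H}
    (hh : ∀ y, V y = 0 → inner ℂ h y = 0) : adjoint V (V h) = h := by
  have hy : V (h - adjoint V (V h)) = 0 := by
    rw [map_sub, apply_adjoint_apply hV, sub_self]
  have : inner ℂ (h - adjoint V (V h)) (h - adjoint V (V h)) = 0 := by
    rw [inner_sub_left, hh _ hy, adjoint_inner_left, hy, inner_zero_right, sub_zero]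
  exact (sub_eq_zero.1 (inner_self_eq_zero.1 this)).symm

/-- A coisometry restricts to a unitary operator on the orthogonal complement of its kernel. -/
lemma exists_unitary_of_coisometry {V : H →L[ℂ] J} (hV : V ∘L adjoint V = .id ℂ J)
    {Q : Submodule ℂ H} (hQ : Q = (LinearMap.ker V.toLinearMap)ᗮ) :
    ∃ U : Q ≃ₗᵢ[ℂ] J, ∀ h : Q, U h = V h := by
  have hmem (h : Q) (y : H) (hy : V y = 0) : inner ℂ (h : H) y = 0 := by
    have hh : (h : H) ∈ (LinearMap.ker V.toLinearMap)ᗮ := hQ ▸ h.2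
    exact Submodule.inner_left_of_mem_orthogonal hy hh
  let I : Q →ₗᵢ[ℂ] J :=
    { toLinearMap := V.toLinearMap ∘ₗ Q.subtype
      norm_map' := fun h => by
        change ‖V h‖ = ‖(h : H)‖
        rw [← sq_eq_sq₀ (norm_nonneg _) (norm_nonneg _), ← inner_self_eq_norm_sq (𝕜 := ℂ),
          ← adjoint_inner_left, adjoint_apply_apply_of_mem hV (hmem h), inner_self_eq_norm_sq] }
  refine ⟨LinearIsometryEquiv.ofSurjective I fun g => ?_, fun h => rfl⟩
  refine ⟨⟨adjoint V g, ?_⟩, apply_adjoint_apply hV g⟩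
  rw [hQ, Submodule.mem_orthogonal]
  intro y hy
  rw [adjoint_inner_right, show V y = 0 from hy, inner_zero_left]

end Coisometry

/-! ### The jets of the monomials -/

section Monomials

open Finset

/-- The Lagrange basis polynomial for the nodes `0, …, n`, evaluated at an integer. -/
noncomputable def lagrangeValue (n i l : ℕ) : ℝ :=
  (Lagrange.basis (range (n + 1)) (fun j : ℕ => (j : ℝ)) i).eval (l : ℝ)

lemma lagrangeValue_node (n : ℕ) {i j : ℕ} (hi : i ≤ n) (hj : j ≤ n) :
    lagrangeValue n i j = if i = j then 1 else 0 := by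
  have hinj : Set.InjOn (fun j : ℕ => (j : ℝ)) (range (n + 1)) :=
    Nat.cast_injective.injOn
  split_ifs with hij
  · subst hij
    exact Lagrange.eval_basis_self hinj (mem_range.2 (Nat.lt_succ_of_le hi))
  · exact Lagrange.eval_basis_of_ne hij (mem_range.2 (Nat.lt_succ_of_le hj))

lemma lagrangeValue_succ_ne_zero (n i : ℕ) : lagrangeValue n i (n + 1) ≠ 0 := by
  rw [lagrangeValue, Lagrange.basis, Polynomial.eval_prod]
  refine prod_ne_zero_iff.2 fun j hj => ?_
  obtain ⟨hji, hj⟩ := mem_erase.1 hj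
  have hj := mem_range.1 hj
  have h1 : (i : ℝ) - j ≠ 0 := sub_ne_zero.2 (Nat.cast_injective.ne (Ne.symm hji))
  have h2 : ((n + 1 : ℕ) : ℝ) - j ≠ 0 := sub_ne_zero.2 (Nat.cast_injective.ne (by omega))
  simpa [Lagrange.basisDivisor, h1] using h2

/-- Falling factorials of order at most `n` are recovered from their values at `0, …, n`. -/
lemma sum_lagrangeValue_mul_descFactorial {n i : ℕ} (hi : i ≤ n) (l : ℕ) :
    ∑ m ∈ range (n + 1), lagrangeValue n m l * (m.descFactorial i : ℝ) = l.descFactorial i := by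
  have hdeg : (descPochhammer ℝ i).degree < (#(range (n + 1)) : ℕ) := by
    rw [card_range]
    refine lt_of_le_of_lt Polynomial.degree_le_natDegree ?_
    rw [descPochhammer_natDegree]
    exact_mod_cast Nat.lt_succ_of_le hi
  have h := Lagrange.eq_interpolate (v := fun j : ℕ => (j : ℝ)) Nat.cast_injective.injOn hdeg
  have h' := congrArg (Polynomial.eval (l : ℝ)) h
  rw [Lagrange.interpolate_apply, Polynomial.eval_finsetSum,
    descPochhammer_eval_eq_descFactorial] at h'
  rw [h']
  refine sum_congr rfl fun m _ => ?_
  rw [Polynomial.eval_mul, Polynomial.eval_C, descPochhammer_eval_eq_descFactorial, lagrangeValue,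
    mul_comm]

/-- A sequence orthogonal to the falling factorials of order at most `n` is orthogonal to the
Lagrange basis. -/
lemma sum_mul_lagrangeValue_eq_zero {n : ℕ} {s : Finset ℕ} {c : ℕ → ℂ}
    (h : ∀ i ≤ n, ∑ m ∈ s, c m * (m.descFactorial i : ℂ) = 0) {l : ℕ} (hl : l ≤ n) :
    ∑ m ∈ s, c m * (lagrangeValue n l m : ℂ) = 0 := by
  have h2 (i : ℕ) (hi : i ≤ n) : ∑ j ∈ range (n + 1),
      (j.descFactorial i : ℂ) * ∑ m ∈ s, c m * (lagrangeValue n j m : ℂ) = 0 := by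
    rw [← h i hi]
    simp only [mul_sum]
    rw [sum_comm]
    refine sum_congr rfl fun m _ => ?_
    have := congrArg (fun x : ℝ => (x : ℂ)) (sum_lagrangeValue_mul_descFactorial hi m)
    simp only [Complex.ofReal_sum, Complex.ofReal_mul, Complex.ofReal_natCast] at this
    rw [← this, mul_sum]
    exact sum_congr rfl fun j _ => by ring
  -- The system is triangular; solve it from the top index downwards.
  induction hk : n - l using Nat.strong_induction_on generalizing l with
  | _ k ih =>
    have h3 := h2 l hl
    rw [sum_eq_single l] at h3
    · refine (mul_eq_zero.1 h3).resolve_left ?_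
      rw [Nat.descFactorial_self]
      exact_mod_cast l.factorial_ne_zero
    · intro j hj hjl
      have hj := mem_range.1 hj
      rcases lt_or_gt_of_ne hjl with hlt | hlt
      · rw [Nat.descFactorial_eq_zero_iff_lt.2 hlt]
        simp
      · rw [ih (n - j) (by omega) (by omega) rfl, mul_zero]
    · intro hl'
      exact absurd (mem_range.2 (Nat.lt_succ_of_le hl)) hl'

variable {α β : ℝ} (hα : 0 < α) (hβ : 0 < β)

/-- The homogeneous components of a vector whose jet vanishes along the diagonal have vanishing
jets. -/
lemma sum_eq_zero_of_jet_eq_zero {y : FeatureSpace} {i : ℕ}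
    (h : ∀ z : Disc, inner ℂ (feature hα hβ i (z, z)) y = 0) (d : ℕ) :
    ∑ m ∈ range (d + 1),
      y (d - m, m) * (monomialWeight α β (d - m, m) : ℂ) * (m.descFactorial i : ℂ) = 0 := by
  let g : ℕ × ℕ → ℂ := fun p => y p * (monomialWeight α β p : ℂ) * (p.2.descFactorial i : ℂ)
  have h1 : (fun d => ∑ p ∈ antidiagonal d, g p) = 0 := by
    refine eq_zero_of_hasSum_zero fun z hz => ?_
    have h2 := (hasSum_inner_feature hα hβ i (.mk z hz, .mk z hz) y).mul_right (z ^ i)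
    rw [h, zero_mul] at h2
    have h3 : HasSum (fun p : ℕ × ℕ => g p * z ^ (p.1 + p.2)) 0 := by
      refine h2.congr_fun ?_
      intro p
      simp only [g, jetMonomial, Complex.UnitDisc.coe_mk]
      rcases lt_or_ge p.2 i with hp | hp
      · rw [Nat.descFactorial_eq_zero_iff_lt.2 hp]
        simp
      · have : z ^ (p.1 + p.2) = z ^ p.1 * (z ^ (p.2 - i) * z ^ i) := by
          rw [← pow_add, ← pow_add]
          congr 1
          omega
        rw [this]
        ring
    have h4 := (HasAntidiagonal.sigmaAntidiagonalEquivProd.hasSum_iff.2 h3).sigma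
      fun d => hasSum_fintype _
    convert! h4 using 2 with d
    rw [sum_mul, ← sum_coe_sort]
    refine sum_congr rfl fun p _ => ?_
    have := mem_antidiagonal.1 p.2
    simp [HasAntidiagonal.sigmaAntidiagonalEquivProd, this]
  have h5 := congrFun h1 d
  simp only [Pi.zero_apply] at h5
  rw [← Nat.sum_antidiagonal_swap, Nat.sum_antidiagonal_eq_sum_range_succ_mk] at h5
  exact h5

/-- The vector of the feature space that represents the monomial `z₁^k z₂^l`. -/
noncomputable def monomialVector (α β : ℝ) (k l : ℕ) : FeatureSpace :=
  ((monomialWeight α β (k, l))⁻¹ : ℂ) • lp.single 2 (k, l) (1 : ℂ)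

lemma inner_monomialVector (k l : ℕ) (x : FeatureSpace) :
    inner ℂ (monomialVector α β k l) x = ((monomialWeight α β (k, l))⁻¹ : ℂ) * x (k, l) := by
  rw [monomialVector, inner_smul_left, lp.inner_single_left]
  simp

lemma monomialVector_apply (k l : ℕ) (p : ℕ × ℕ) :
    monomialVector α β k l p = if p = (k, l) then ((monomialWeight α β (k, l))⁻¹ : ℂ) else 0 := by
  simp [monomialVector, Pi.single_apply]

lemma inner_feature_monomialVector (i : ℕ) (z : Disc) (k l : ℕ) :
    inner ℂ (feature hα hβ i (z, z)) (monomialVector α β k l) =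
      (z : ℂ) ^ k * ((l.descFactorial i : ℂ) * (z : ℂ) ^ (l - i)) := by
  have hw : (monomialWeight α β (k, l) : ℂ) ≠ 0 :=
    Complex.ofReal_ne_zero.2 (monomialWeight_pos hα hβ _).ne'
  rw [← inner_conj_symm, inner_monomialVector, feature_apply]
  simp only [jetMonomial, map_mul, Complex.conj_conj, map_inv₀, Complex.conj_ofReal]
  field_simp

variable {J : Type*} [NormedAddCommGroup J] [InnerProductSpace ℂ J] [CompleteSpace J] {n : ℕ}
  [RKHS ℂ J Disc (Jets n)]

open ContinuousLinearMap

/-- Biorthogonality holds because the vector `q` below lies in the initial space of the coisometry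
`V`: a vector with zero jet has zero jet in every degree, and so is orthogonal to `q`. -/
lemma isJetSystem_monomials {V : FeatureSpace →L[ℂ] J}
    (hV : ∀ e z, V e z = adjoint (jetFeature hα hβ n z) e) (hV1 : V ∘L adjoint V = .id ℂ J)
    {M : J →L[ℂ] J} (hM : ∀ f z, M f z = (z : ℂ) • f z) :
    IsJetSystem n (negBinom α) (negBinom β) (lagrangeValue n) M
      (fun k l => V (monomialVector α β k l)) where
  pos_left := negBinom_pos hα
  pos_right := negBinom_pos hβ
  node i hi j hj := lagrangeValue_node n hi hj
  node_succ i _ := lagrangeValue_succ_ne_zero n i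
  map k l := by
    ext z i
    rw [hM, hV, hV, PiLp.smul_apply, adjoint_jetFeature_apply, adjoint_jetFeature_apply,
      inner_feature_monomialVector, inner_feature_monomialVector, smul_eq_mul]
    ring
  total x hx := by
    have : adjoint V x = 0 := by
      ext p
      have h1 := hx p.1 p.2
      rw [← adjoint_inner_right, inner_monomialVector] at h1
      have hw : (monomialWeight α β (p.1, p.2) : ℂ) ≠ 0 :=
        Complex.ofReal_ne_zero.2 (monomialWeight_pos hα hβ _).ne'
      exact (mul_eq_zero.1 h1).resolve_left (inv_ne_zero hw)
    rw [← apply_adjoint_apply hV1 x, this, map_zero]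
  interp k l := by
    have hvec : V (monomialVector α β k l) = V (∑ i ∈ range (n + 1),
        (lagrangeValue n i l : ℂ) • monomialVector α β (k + l - i) i) := by
      ext z i
      have hi : (i : ℕ) ≤ n := Nat.lt_succ_iff.1 i.2
      rw [hV, hV, adjoint_jetFeature_apply, adjoint_jetFeature_apply, inner_sum,
        inner_feature_monomialVector]
      have h1 : (z : ℂ) ^ k * ((l.descFactorial i : ℂ) * (z : ℂ) ^ (l - i)) =
          (l.descFactorial i : ℂ) * (z : ℂ) ^ (k + l - i) := by
        rcases lt_or_ge l i with hl | hl
        · rw [Nat.descFactorial_eq_zero_iff_lt.2 hl]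
          simp
        · rw [show k + l - i = k + (l - i) by omega, pow_add]
          ring
      have h2 := congrArg (fun x : ℝ => (x : ℂ)) (sum_lagrangeValue_mul_descFactorial hi l)
      simp only [Complex.ofReal_sum, Complex.ofReal_mul, Complex.ofReal_natCast] at h2
      rw [h1, ← h2, sum_mul]
      refine sum_congr rfl fun m hm => ?_
      rw [inner_smul_right, inner_feature_monomialVector]
      have hm := mem_range.1 hm
      rcases lt_or_ge m i with hmi | hmi
      · rw [Nat.descFactorial_eq_zero_iff_lt.2 hmi]
        simp
      -- If `m > k + l`, the truncated exponent `k + l - m` is harmless: then `l` is a node.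
      rcases lt_or_ge (k + l) m with hml | hml
      · rw [lagrangeValue_node n (by omega) (by omega), if_neg (by omega)]
        simp
      · rw [show k + l - i = (k + l - m) + (m - i) by omega, pow_add]
        ring
    simpa only [map_sum, map_smul] using hvec
  inner_dual d l hl k j := by
    let q : FeatureSpace := ∑ m ∈ range (d + 1),
      ((negBinom α (d - m) * negBinom β m * lagrangeValue n l m : ℝ) : ℂ) •
        monomialVector α β (d - m) m
    have hq : dualVector (negBinom α) (negBinom β) (lagrangeValue n)
        (fun k l => V (monomialVector α β k l)) d l = V q := by
      simp only [dualVector, q, map_sum, map_smul]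
    have hqy (y : FeatureSpace) : inner ℂ q y = ∑ m ∈ range (d + 1),
        y (d - m, m) * (monomialWeight α β (d - m, m) : ℂ) * (lagrangeValue n l m : ℂ) := by
      rw [sum_inner]
      refine sum_congr rfl fun m _ => ?_
      have hw : (monomialWeight α β (d - m, m) : ℂ) ≠ 0 :=
        Complex.ofReal_ne_zero.2 (monomialWeight_pos hα hβ _).ne'
      have hw2 := monomialWeight_mul_self hα hβ (d - m, m)
      rw [inner_smul_left, inner_monomialVector, ← hw2]
      rw [Complex.conj_ofReal, Complex.ofReal_mul, Complex.ofReal_mul]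
      field_simp
    have hqV : adjoint V (V q) = q := by
      refine adjoint_apply_apply_of_mem hV1 fun y hy => ?_
      rw [hqy]
      refine sum_mul_lagrangeValue_eq_zero (fun i hi => ?_) hl
      refine sum_eq_zero_of_jet_eq_zero hα hβ (fun z => ?_) d
      rw [← adjoint_jetFeature_apply hα hβ n z y ⟨i, Nat.lt_succ_of_le hi⟩, ← hV, hy]
      simp
    rw [hq, ← adjoint_inner_left, hqV, hqy]
    simp only [monomialVector_apply]
    split_ifs with hkj
    · have hw : (monomialWeight α β (k, j) : ℂ) ≠ 0 :=
        Complex.ofReal_ne_zero.2 (monomialWeight_pos hα hβ _).ne'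
      rw [sum_eq_single_of_mem j (mem_range.2 (by omega)),
        show d - j = k by omega, if_pos rfl, inv_mul_cancel₀ hw, one_mul]
      intro m _ hmj
      rw [if_neg fun hp => hmj (congrArg Prod.snd hp), zero_mul, zero_mul]
    · refine sum_eq_zero fun m hm => ?_
      have hm := mem_range.1 hm
      rw [if_neg, zero_mul, zero_mul]
      intro hp
      have h1 := congrArg Prod.fst hp
      have h2 := congrArg Prod.snd hp
      simp only at h1 h2
      omega

end Monomials

/-! ### The jet map and the multiplication operators -/

section JetMap

open ContinuousLinearMap

variable {α β : ℝ} (hα : 0 < α) (hβ : 0 < β) {n : ℕ}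
  {H : Type*} [NormedAddCommGroup H] [InnerProductSpace ℂ H]
  [RKHS ℂ H (Disc × Disc) ℂ]
  {J : Type*} [NormedAddCommGroup J] [InnerProductSpace ℂ J]
  [RKHS ℂ J Disc (Jets n)]
  {V₀ : FeatureSpace →L[ℂ] H} {V₁ : FeatureSpace →L[ℂ] J} {B : FeatureSpace →L[ℂ] FeatureSpace}

/-- The function in `J` represented by a vector of the feature space is the jet of the function in
`H` represented by the same vector. -/
lemma apply_eq_jet (h₀ : ∀ e z, V₀ e z = adjoint (bidiscFeature hα hβ z) e)
    (h₁ : ∀ e z, V₁ e z = adjoint (jetFeature hα hβ n z) e) (e : FeatureSpace) (z : Disc) :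
    V₁ e z = jet n (V₀ e : Disc × Disc → ℂ) z := by
  ext i
  rw [h₁, adjoint_jetFeature_apply]
  refine (diagDeriv_eq_inner_feature hα hβ (fun w => ?_) i z).symm
  rw [h₀, adjoint_bidiscFeature_apply]

lemma bidisc_shift_apply (h₀ : ∀ e z, V₀ e z = adjoint (bidiscFeature hα hβ z) e)
    (hB : ∀ i z, B (feature hα hβ i z) = conj (z.1 : ℂ) • feature hα hβ i z)
    (e : FeatureSpace) (z : Disc × Disc) : V₀ (adjoint B e) z = (z.1 : ℂ) * V₀ e z := by
  rw [h₀, h₀, adjoint_bidiscFeature_apply, adjoint_bidiscFeature_apply, adjoint_inner_right, hB,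
    inner_smul_left, Complex.conj_conj]

lemma jet_shift_apply (h₁ : ∀ e z, V₁ e z = adjoint (jetFeature hα hβ n z) e)
    (hB : ∀ i z, B (feature hα hβ i z) = conj (z.1 : ℂ) • feature hα hβ i z)
    (e : FeatureSpace) (z : Disc) : V₁ (adjoint B e) z = (z : ℂ) • V₁ e z := by
  ext i
  rw [h₁, h₁, PiLp.smul_apply, adjoint_jetFeature_apply, adjoint_jetFeature_apply,
    adjoint_inner_right, hB, inner_smul_left, Complex.conj_conj, smul_eq_mul]

lemma quotientModule_eq {V : H →L[ℂ] J} (hV : ∀ f z, V f z = jet n (f : Disc × Disc → ℂ) z) :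
    quotientModule H n = (LinearMap.ker V.toLinearMap)ᗮ := by
  have hset : {f : H | VanishesOnDiagonal n (f : Disc × Disc → ℂ)} =
      (LinearMap.ker V.toLinearMap : Set H) := by
    ext f
    simp only [Set.mem_ofPred_eq, SetLike.mem_coe, LinearMap.mem_ker]
    constructor
    · intro hf
      refine RKHS.ext fun z => ?_
      ext i
      change V f z i = (0 : J) z i
      rw [hV, RKHS.coe_zero]
      exact hf i (Nat.lt_succ_iff.1 i.2) z
    · intro hf i hi z
      have hf : V f = 0 := hf
      have h1 := hV f z
      rw [hf, RKHS.coe_zero] at h1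
      exact (congrArg (fun v : Jets n => v ⟨i, Nat.lt_succ_of_le hi⟩) h1).symm
  rw [quotientModule, hset, Submodule.span_eq]

end JetMap

end JetConstruction

theorem mainTheorem1 (α β : ℝ) (hα : 0 < α) (hβ : 0 < β) (n : ℕ) (hn : 1 ≤ n) :
    (JetConstruction.bidiscKernel α β).PosSemidef ∧
    (JetConstruction.jetKernel α β n).PosSemidef ∧
    ∀ (H : Type*) [NormedAddCommGroup H] [InnerProductSpace ℂ H] [CompleteSpace H]
      [RKHS ℂ H (JetConstruction.Disc × JetConstruction.Disc) ℂ]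
      (J : Type*) [NormedAddCommGroup J] [InnerProductSpace ℂ J] [CompleteSpace J]
      [RKHS ℂ J JetConstruction.Disc (JetConstruction.Jets n)],
      RKHS.kernel H = JetConstruction.bidiscKernel α β →
      RKHS.kernel J = JetConstruction.jetKernel α β n →
      ∃ (M₁ : H →L[ℂ] H) (M : J →L[ℂ] J)
        (U : JetConstruction.quotientModule H n ≃ₗᵢ[ℂ] J),
        (∀ (f : H) (z : JetConstruction.Disc × JetConstruction.Disc),
          M₁ f z = (z.1 : ℂ) * f z) ∧
        (∀ (f : J) (z : JetConstruction.Disc), M f z = (z : ℂ) • f z) ∧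
        (∀ (h : JetConstruction.quotientModule H n) (z : JetConstruction.Disc),
          U h z = JetConstruction.jet n ((h : H) : JetConstruction.Disc × JetConstruction.Disc → ℂ) z) ∧
        (∀ h : JetConstruction.quotientModule H n,
          U (JetConstruction.compression M₁ (JetConstruction.quotientModule H n) h) = M (U h)) ∧
        JetConstruction.IsIrreducibleOperator M := by
  open JetConstruction ContinuousLinearMap in
  have hfH := isFeatureMap_bidiscKernel hα hβ
  have hfJ := isFeatureMap_jetKernel hα hβ n
  refine ⟨hfH.posSemidef, hfJ.posSemidef, ?_⟩
  intro H _ _ _ _ J _ _ _ _ hH hJ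
  rw [← hH] at hfH
  rw [← hJ] at hfJ
  obtain ⟨V₀, h₀, hV₀⟩ := hfH.exists_coisometry
  obtain ⟨V₁, h₁, hV₁⟩ := hfJ.exists_coisometry
  obtain ⟨B, hB⟩ := exists_backward_shift hα hβ
  have hjet := apply_eq_jet hα hβ h₀ h₁
  -- `V₁` factors through `V₀`, as `V₁ e` is the jet of `V₀ e`.
  have hfactor (e : FeatureSpace) : V₁ (adjoint V₀ (V₀ e)) = V₁ e :=
    RKHS.ext fun z => by rw [hjet, hjet, apply_adjoint_apply hV₀]
  let V : H →L[ℂ] J := V₁ ∘L adjoint V₀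
  have hVjet (f : H) (z : Disc) : V f z = jet n (f : Disc × Disc → ℂ) z := by
    rw [comp_apply, hjet, apply_adjoint_apply hV₀]
  have hV : V ∘L adjoint V = .id ℂ J := by
    refine ContinuousLinearMap.ext fun g => ?_
    rw [adjoint_comp, adjoint_adjoint]
    change V₁ (adjoint V₀ (V₀ (adjoint V₁ g))) = g
    rw [hfactor, apply_adjoint_apply hV₁]
  have hQ := quotientModule_eq hVjet
  obtain ⟨U, hU⟩ := exists_unitary_of_coisometry hV hQ
  have hM₁ (f : H) (z : Disc × Disc) :
      (V₀ ∘L adjoint B ∘L adjoint V₀) f z = (z.1 : ℂ) * f z := by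
    change V₀ (adjoint B (adjoint V₀ f)) z = _
    rw [bidisc_shift_apply hα hβ h₀ hB, apply_adjoint_apply hV₀]
  have hM (f : J) (z : Disc) : (V₁ ∘L adjoint B ∘L adjoint V₁) f z = (z : ℂ) • f z := by
    change V₁ (adjoint B (adjoint V₁ f)) z = _
    rw [jet_shift_apply hα hβ h₁ hB, apply_adjoint_apply hV₁]
  refine ⟨V₀ ∘L adjoint B ∘L adjoint V₀, V₁ ∘L adjoint B ∘L adjoint V₁, U, hM₁, hM,
    fun h z => by rw [hU, hVjet], fun h => ?_,
    (isJetSystem_monomials hα hβ h₁ hV₁ hM).isIrreducibleOperator⟩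
  -- `V` annihilates the orthogonal complement of the quotient module.
  have hVQ (f : H) : V ((quotientModule H n).starProjection f) = V f := by
    have h1 := (quotientModule H n).sub_starProjection_mem_orthogonal f
    have hclosed : IsClosed ((LinearMap.ker V.toLinearMap : Submodule ℂ H) : Set H) := V.isClosed_ker
    have : CompleteSpace (LinearMap.ker V.toLinearMap) := hclosed.completeSpace_coe
    have h2 : f - (quotientModule H n).starProjection f ∈ (quotientModule H n)ᗮ := h1
    rw [congrArg Submodule.orthogonal hQ, Submodule.orthogonal_orthogonal] at h2
    have h3 : V (f - (quotientModule H n).starProjection f) = 0 := h2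
    rw [map_sub, sub_eq_zero] at h3
    exact h3.symm
  refine RKHS.ext fun z => ?_
  rw [hM, hU, hU]
  change V ((quotientModule H n).starProjection (V₀ (adjoint B (adjoint V₀ h)))) z = _
  rw [hVQ]
  change V₁ (adjoint V₀ (V₀ (adjoint B (adjoint V₀ h)))) z = (z : ℂ) • V₁ (adjoint V₀ h) z
  rw [hfactor, jet_shift_apply hα hβ h₁ hB]
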